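/- Let $q\ge 1$, $m\ge 0$ and $n\ge 1$ be integers and $\mathbb{G}=\mathbb{Z}_q=\mathbb{Z}/q\mathbb{Z}$. For $k\ge1$ and $x\in\mathbb{G}$ let $\mathcal{R}_k(x)$ be a uniformly random tuple in $\mathbb{G}^k$ conditioned on having sum $x$ (additive shares of $x$). The *$m$-parallel IKOS protocol with randomized inputs* is the randomized map $\tilde{\mathcal{V}}_{m,n}:\mathbb{G}^n\to(\mathbb{G}^n)^{m+1}$ defined as follows. On input $(x_1,\dots,x_n)$, each user $i\in\{1,\dots,n\}$ independently samples $m+1$ shares $(Y_i^{(1)},\dots,Y_i^{(m+1)})=\mathcal{R}_{m+1}(x_i)$. For each $j\in\{1,\dots,m\}$ the tuple $(Y_1^{(j)},\dots,Y_n^{(j)})$ is permuted by a uniformly random permutation (a shuffler), the $m$ permutations being independent of each other and of the shares. The output (the view of the aggregator) consists of the $m$ shuffled tuples followed by the unshuffled tuple $(Y_1^{(m+1)},\dots,Y_n^{(m+1)})$. The analyzer outputs the sum of all the $(m+1)n$ messages in the view. The protocol *computes exact summation* if on every input $x\in\mathbb{G}^n$ the analyzer outputs $\sum_i x_i$ with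 probability $1$. It has *worst-case statistical security with parameter $\sigma\in\mathbb{R}$* if it computes exact summation and, for all $x,x'\in\mathbb{G}^n$ with $\sum_i x_i=\sum_i x'_i$, the total variation distance between the laws of $\tilde{\mathcal{V}}_{m,n}(x)$ and $\tilde{\mathcal{V}}_{m,n}(x')$ is at most $2^{-\sigma}$. 1. For all $q\ge1$, $m\geq 3$ and $n\geq 19$, the protocol $\tilde{\mathcal{V}}_{m,n}$ over $\mathbb{Z}_q$ has worst-case statistical security with parameter $$\sigma=\frac{(m-1)(\log_2 n-\log_2 e)-\log_2 q}{2}.$$ 2. Consequently, for all $q\ge1$, $n\ge19$ and $\sigma\in\mathbb{R}$, if $$m=\left\lceil\frac{2\sigma+\log_2 q}{\log_2 n-\log_2 e}+1\right\rceil\ge 0,$$ then the protocol $\tilde{\mathcal{V}}_{m,n}$ over $\mathbb{Z}_q$, which uses $m$ shuffled messages per user and one unshuffled message per user, has worst-case statistical security with parameter $\sigma$. 3. For fixed $q$ and $\sigma$ this number of shuffled messages decreases as $n$ grows, in the following sense: if $2\sigma+\log_2 q\ge0$, then the integer $\left\lceil\frac{2\sigma+\log_2 q}{\log_2 n-\log_2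 e}+1\right\rceil$ is non-increasing in the integer $n\ge19$; and if $2\sigma+\log_2 q>0$, then $\frac{2\sigma+\log_2 q}{\log_2 n-\log_2 e}+1$ is strictly decreasing in the integer $n\ge19$. -/

import Mathlib

namespace ShuffleSum

open scoped ENNReal

noncomputable section

/-- The joint law of independent random variables, the `i`-th of which has law `p i`. -/
def indep {ι α : Type*} [Fintype ι] [DecidableEq ι] [Fintype α] (p : ι → PMF α) :
    PMF (ι → α) :=
  PMF.ofFintype (fun f => ∏ i, p i (f i)) (by
    have h := (Finset.prod_univ_sum (fun _ : ι => (Finset.univ : Finset α))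
      (fun i a => p i a)).symm
    rw [Fintype.piFinset_univ] at h
    rw [h]
    refine Finset.prod_eq_one fun i _ => ?_
    have hi := (p i).tsum_coe
    rwa [tsum_fintype] at hi)

/-- Total variation (statistical) distance between two probability distributions on a
discrete space: half of the `ℓ¹` distance between the mass functions. -/
def tvDist {α : Type*} (p r : PMF α) : ℝ :=
  (∑' a, |(p a).toReal - (r a).toReal|) / 2

section Protocol

variable {G : Type*} [AddCommGroup G] [Fintype G] [DecidableEq G]

/-- The set of `m`-tuples of group elements with sum `x`. -/
def shareSet (m : ℕ) (x : G) : Finset (Fin m → G) :=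
  Finset.univ.filter fun y => ∑ j, y j = x

theorem shareSet_nonempty (m : ℕ) [NeZero m] (x : G) : (shareSet m x).Nonempty :=
  ⟨Pi.single 0 x, by simp [shareSet]⟩

/-- The local randomizer `R_m(x)`: a uniformly random tuple `(Y⁽¹⁾, …, Y⁽ᵐ⁾)` conditioned on
having sum `x` (additive shares of `x`). -/
def additiveShares (m : ℕ) [NeZero m] (x : G) : PMF (Fin m → G) :=
  PMF.uniformOfFinset (shareSet m x) (shareSet_nonempty m x)

/-- A shuffler: apply a uniformly random permutation to the tuple of its `n` inputs. -/
def shuffler {n : ℕ} (y : Fin n → G) : PMF (Fin n → G) :=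
  (PMF.uniformOfFintype (Equiv.Perm (Fin n))).map fun π : Equiv.Perm (Fin n) => y ∘ π

/-- View of the aggregator in the `m`-parallel IKOS protocol with randomized inputs. Every user
`i` independently samples `m + 1` additive shares `Y i` of the input `x i`; for each of the first
`m` share positions `j`, the `j`-th shares of all the users are shuffled, with independent
shufflers; the last shares are appended unshuffled. -/
def ikosRandomizedInputs (m n : ℕ) (x : Fin n → G) : PMF (Fin (m + 1) → Fin n → G) :=
  (indep fun i : Fin n => additiveShares (m + 1) (x i)).bind fun Y =>
    (indep fun j : Fin m => shuffler fun i => Y i j.castSucc).map fun Z =>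
      Fin.snoc (α := fun _ => Fin n → G) Z fun i => Y i (Fin.last m)

/-- The analyzer of the protocol adds up all the messages that it receives. -/
def sumAnalyzer (k n : ℕ) (v : Fin k → Fin n → G) : G :=
  ∑ j, ∑ i, v j i

/-- A protocol, given by the view `V` of the aggregator and the analyzer `A`, computes exact
summation if its output `A (V x)` is, with probability one, the sum of the inputs. -/
def ComputesExactSummation {n : ℕ} {Ω : Type*} (V : (Fin n → G) → PMF Ω) (A : Ω → G) : Prop :=
  ∀ x : Fin n → G, (V x).map A = PMF.pure (∑ i, x i)

/-- Worst-case statistical security with parameter `σ`: the protocol computes exact summation,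
and the views on any two inputs with the same sum are at total variation distance at most
`2 ^ (-σ)`. -/
def WorstCaseSecure {n : ℕ} {Ω : Type*} (V : (Fin n → G) → PMF Ω) (A : Ω → G) (σ : ℝ) : Prop :=
  ComputesExactSummation V A ∧
    ∀ x x' : Fin n → G, ∑ i, x i = ∑ i, x' i → tvDist (V x) (V x') ≤ (2 : ℝ) ^ (-σ)

end Protocol

/-- `σ = ((m - 1)(log₂ n - log₂ e) - log₂ q) / 2`. -/
def securityParameter (q m n : ℕ) : ℝ :=
  (((m : ℝ) - 1) * (Real.logb 2 n - Real.logb 2 (Real.exp 1)) - Real.logb 2 q) / 2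

/-- `(2σ + log₂ q) / (log₂ n - log₂ e) + 1`. -/
def messageBound (q n : ℕ) (σ : ℝ) : ℝ :=
  (2 * σ + Real.logb 2 q) / (Real.logb 2 n - Real.logb 2 (Real.exp 1)) + 1

end

end ShuffleSum

namespace ShuffleSum

open scoped ENNReal Nat
open Finset

/-! ### Sums of products of factorials -/

/-! Security follows from a collision bound. The mass of the view at `v` is proportional to the
number of tuples of permutations `π` consistent with `v`, since `π` and `v` determine all the
shares. Its second moment therefore counts triples `(π, τ, z)` with equal shuffled sums. Character
orthogonality, used twice (`card_shuffledSum_eq`), turns this into a count of maps `f : Fin n → ZMod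
q` with `f ∘ π j = f ∘ τ j` for all `j`, and summing over `π, τ` gives `∑ f, (n! ∏ c, (fiberCard f
c)!) ^ m`.

Grouping the maps by fibre sizes `k` costs a multinomial coefficient and leaves `T = ∑ k, ∏ c, (k
c)! ^ (m - 1)`. The `q` constant maps contribute the main term `q * n! ^ (m - 1)`. If `q ≤ (n / e) ^
(m - 1)`, all the others add at most `q ^ 2 * (e / n) ^ (m - 1) * n! ^ (m - 1)`
(`compositionBound_le`).

Hence the collision probability times the number of views with the right sum is at most `1 + B ^ 2`,
where `B ^ 2 = q * (e / n) ^ (m - 1)`. By Cauchy–Schwarz each view is within `B` in `ℓ¹` of the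
uniform law on those views, so two views are within `B = 2 ^ (-σ)` in total variation. If `B ≥ 1`
there is nothing to prove. The message count comes from solving for `m`, and its monotonicity from
`log₂ n - log₂ e` being positive and increasing for `n ≥ 19`. -/

theorem factorial_mul_factorial_le (d i n : ℕ) (hd : d ≤ i) (hi : i + d ≤ n) :
    i ! * (n - i)! ≤ d ! * (n - d)! := by
  obtain ⟨t, rfl⟩ := Nat.exists_eq_add_of_le hd
  obtain ⟨u, rfl⟩ := Nat.exists_eq_add_of_le hi
  rw [show d + t + d + u - (d + t) = d + u by omega,
    show d + t + d + u - d = d + u + t by omega,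
    ← Nat.factorial_mul_ascFactorial d t, ← Nat.factorial_mul_ascFactorial (d + u) t]
  have h : (d + 1).ascFactorial t ≤ (d + u + 1).ascFactorial t :=
    Nat.ascFactorial_le t (by omega)
  calc d ! * (d + 1).ascFactorial t * (d + u)! = d ! * ((d + u)! * (d + 1).ascFactorial t) := by ring
    _ ≤ _ := by gcongr

theorem sum_factorial_mul_factorial_le (n : ℕ) :
    ∑ k ∈ Ico 1 (n + 1), ((k ! : ℝ) * ((n + 1 - k)! : ℝ)) ≤ 25 / 8 * (n ! : ℝ) := by
  obtain hn | hn := lt_or_ge n 5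
  · interval_cases n <;> simp [sum_Ico_succ_top, Nat.factorial] <;> norm_num
  obtain ⟨t, rfl⟩ := Nat.exists_eq_add_of_le' hn
  -- With `n = t + 5`, the two outermost terms at each end are kept exactly and the `t + 1` middle
  -- ones are bounded by `3! (n - 2)!`. The constant is nearly tight: at `n = 5` the ratio is `372 /
  -- 120 = 3.1`.
  have hmid : ∑ k ∈ Ico 3 (t + 4), ((k ! : ℝ) * ((t + 5 + 1 - k)! : ℝ)) ≤
      (t + 1) * (6 * ((t + 3)! : ℝ)) := by
    have : ∀ k ∈ Ico 3 (t + 4), ((k ! : ℝ) * ((t + 5 + 1 - k)! : ℝ)) ≤ 6 * ((t + 3)! : ℝ) := by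
      intro k hk
      rw [mem_Ico] at hk
      have h := factorial_mul_factorial_le 3 k (t + 5 + 1) hk.1 (by omega)
      exact_mod_cast h
    refine (sum_le_card_nsmul _ _ _ this).trans (le_of_eq ?_)
    rw [Nat.card_Ico, nsmul_eq_mul, show t + 4 - 3 = t + 1 by omega]
    push_cast
    ring
  rw [sum_Ico_succ_top (by omega), sum_Ico_succ_top (by omega), sum_eq_sum_Ico_succ_bot (by omega),
    sum_eq_sum_Ico_succ_bot (by omega)]
  rw [show t + 5 + 1 - 1 = t + 5 by omega, show t + 5 + 1 - (1 + 1) = t + 4 by omega,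
    show t + 5 + 1 - (t + 4) = 2 by omega, show t + 5 + 1 - (t + 5) = 1 by omega]
  have e5 : ((t + 5)! : ℝ) = (t + 5) * (t + 4) * ((t + 3)! : ℝ) := by
    rw [Nat.factorial_succ (t + 4), Nat.factorial_succ (t + 3)]
    push_cast
    ring
  have e4 : ((t + 4)! : ℝ) = (t + 4) * ((t + 3)! : ℝ) := by
    rw [Nat.factorial_succ (t + 3)]
    push_cast
    ring
  norm_num [e5, e4] at hmid ⊢
  have hp : (0 : ℝ) < ((t + 3)! : ℝ) := by positivity
  have ht : (0 : ℝ) ≤ t := by positivity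
  have : 0 ≤ (9 / 8 * (t : ℝ) ^ 2 + t / 8 + 1 / 2) * ((t + 3)! : ℝ) := by positivity
  linarith

theorem sum_factorial_pow_mul_le (s n : ℕ) (hs : 1 ≤ s) :
    ∑ k ∈ Ico 1 (n + 1), ((k ! : ℝ) ^ s * ((n + 1 - k)! : ℝ) ^ s) ≤ 25 / 8 * (n ! : ℝ) ^ s := by
  have hn : (0 : ℝ) < (n ! : ℝ) := by positivity
  -- Of the `s` factors `k! (n + 1 - k)!`, one is kept for the summation and the others are replaced
  -- by their maximum `n!`.
  have key : ∀ k ∈ Ico 1 (n + 1), ((k ! : ℝ) ^ s * ((n + 1 - k)! : ℝ) ^ s) ≤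
      (k ! : ℝ) * ((n + 1 - k)! : ℝ) * (n ! : ℝ) ^ (s - 1) := by
    intro k hk
    rw [mem_Ico] at hk
    have h := factorial_mul_factorial_le 1 k (n + 1) hk.1 (by omega)
    have h' : (k ! : ℝ) * ((n + 1 - k)! : ℝ) ≤ (n ! : ℝ) := by
      have := h
      simp only [Nat.factorial_one, one_mul, Nat.add_sub_cancel] at this
      exact_mod_cast this
    obtain ⟨t, rfl⟩ : ∃ t, s = t + 1 := ⟨s - 1, by omega⟩
    rw [← mul_pow, pow_succ', Nat.add_sub_cancel]
    gcongr
  refine (sum_le_sum key).trans ?_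
  rw [← sum_mul]
  obtain ⟨t, rfl⟩ : ∃ t, s = t + 1 := ⟨s - 1, by omega⟩
  rw [Nat.add_sub_cancel, pow_succ', ← mul_assoc]
  exact mul_le_mul_of_nonneg_right (sum_factorial_mul_factorial_le n) (by positivity)

/-- Upper bound for the sum over all `k : Fin q → ℕ` with `∑ k = n` of `(∏ (k i)!) ^ s`. -/
noncomputable def compositionBound (s q n : ℕ) : ℝ :=
  ∑ j ∈ range n, (q.choose (j + 1) : ℝ) * (25 / 8) ^ j * ((n - j)! : ℝ) ^ s

/-- The index `j` stands for `j + 1` nonzero parts. The three terms on the left correspond to a new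
coordinate equal to `0`, to `n`, or strictly between. In the last case merging the new part with the
rest costs a factor `25 / 8` and raises `j` by one; Pascal's rule then collects the terms. -/
theorem compositionBound_succ (s q n : ℕ) (hs : 1 ≤ s) (hn : 1 ≤ n) :
    compositionBound s q n + (n ! : ℝ) ^ s +
      ∑ k ∈ Ico 1 n, (k ! : ℝ) ^ s * compositionBound s q (n - k) ≤
    compositionBound s (q + 1) n := by
  obtain ⟨n, rfl⟩ : ∃ r, n = r + 1 := ⟨n - 1, by omega⟩
  have hswap : ∑ k ∈ Ico 1 (n + 1), (k ! : ℝ) ^ s * compositionBound s q (n + 1 - k) =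
      ∑ j ∈ range n, (q.choose (j + 1) : ℝ) * (25 / 8) ^ j *
        ∑ k ∈ Ico 1 (n - j + 1), ((k ! : ℝ) ^ s * ((n - j - k + 1)! : ℝ) ^ s) := by
    simp only [compositionBound, mul_sum]
    refine (sum_comm' ?_).trans (sum_congr rfl fun j hj => sum_congr rfl fun k hk => ?_)
    · intro k j
      simp only [mem_Ico, mem_range]
      omega
    · rw [mem_Ico] at hk
      rw [show n + 1 - k - j = n - j - k + 1 by omega]
      ring
  have hle : ∑ j ∈ range n, (q.choose (j + 1) : ℝ) * (25 / 8) ^ j *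
        ∑ k ∈ Ico 1 (n - j + 1), ((k ! : ℝ) ^ s * ((n - j - k + 1)! : ℝ) ^ s) ≤
      ∑ j ∈ range n, (q.choose (j + 1) : ℝ) * (25 / 8) ^ (j + 1) * ((n - j)! : ℝ) ^ s := by
    refine sum_le_sum fun j hj => ?_
    have h := sum_factorial_pow_mul_le s (n - j) hs
    have h' : ∑ k ∈ Ico 1 (n - j + 1), ((k ! : ℝ) ^ s * ((n - j - k + 1)! : ℝ) ^ s) ≤
        25 / 8 * ((n - j)! : ℝ) ^ s := by
      refine le_trans (le_of_eq (sum_congr rfl fun k hk => ?_)) h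
      rw [mem_Ico] at hk
      rw [show n - j + 1 - k = n - j - k + 1 by omega]
    calc _ ≤ (q.choose (j + 1) : ℝ) * (25 / 8) ^ j * (25 / 8 * ((n - j)! : ℝ) ^ s) := by gcongr
      _ = _ := by ring
  have hpascal : compositionBound s (q + 1) (n + 1) = compositionBound s q (n + 1) +
      ∑ j ∈ range (n + 1), (q.choose j : ℝ) * (25 / 8) ^ j * ((n + 1 - j)! : ℝ) ^ s := by
    rw [compositionBound, compositionBound, ← sum_add_distrib]
    refine sum_congr rfl fun j _ => ?_
    rw [Nat.choose_succ_succ]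
    push_cast
    ring
  rw [hpascal, hswap, sum_range_succ']
  simp only [Nat.add_sub_add_right, Nat.choose_zero_right, Nat.cast_one, pow_zero, one_mul,
    Nat.sub_zero]
  linarith

theorem sum_piAntidiag_le {ι : Type*} [DecidableEq ι] (s : ℕ) (hs : 1 ≤ s) (t : Finset ι) :
    ∀ n, 1 ≤ n → ∑ k ∈ piAntidiag t n, ∏ i ∈ t, ((k i)! : ℝ) ^ s ≤ compositionBound s #t n := by
  induction t using Finset.cons_induction with
  | empty =>
    intro n hn
    rw [piAntidiag_empty_of_ne_zero (by omega)]
    simp [compositionBound]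
  | cons i t hi ih =>
    intro n hn
    rw [card_cons]
    refine le_trans ?_ (compositionBound_succ s #t n hs hn)
    have : ∑ k ∈ piAntidiag (cons i t hi) n, ∏ j ∈ cons i t hi, ((k j)! : ℝ) ^ s =
        ∑ p ∈ antidiagonal n, ((p.1)! : ℝ) ^ s *
          ∑ k ∈ piAntidiag t p.2, ∏ j ∈ t, ((k j)! : ℝ) ^ s := by
      rw [piAntidiag_cons, sum_disjiUnion]
      refine sum_congr rfl fun p hp => ?_
      rw [sum_map, mul_sum]
      refine sum_congr rfl fun k hk => ?_
      rw [prod_cons]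
      rw [mem_piAntidiag] at hk
      have hki : k i = 0 := by
        by_contra h
        exact hi (hk.2 i h)
      congr 1
      · simp [hki]
      · refine prod_congr rfl fun j hj => ?_
        have : j ≠ i := fun h => hi (h ▸ hj)
        simp [this]
    rw [this, Nat.sum_antidiagonal_eq_sum_range_succ_mk]
    obtain ⟨n, rfl⟩ : ∃ r, n = r + 1 := ⟨n - 1, by omega⟩
    rw [sum_range_succ, range_eq_Ico, sum_eq_sum_Ico_succ_bot (by omega)]
    simp only [Nat.factorial_zero, Nat.cast_one, one_pow, one_mul, Nat.sub_zero, Nat.sub_self,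
      piAntidiag_zero, sum_singleton, Pi.zero_apply, prod_const_one, mul_one, zero_add]
    have h1 := ih (n + 1) (by omega)
    have h2 : ∑ k ∈ Ico 1 (n + 1), (k ! : ℝ) ^ s * ∑ l ∈ piAntidiag t (n + 1 - k),
        ∏ j ∈ t, ((l j)! : ℝ) ^ s ≤
        ∑ k ∈ Ico 1 (n + 1), (k ! : ℝ) ^ s * compositionBound s #t (n + 1 - k) := by
      refine sum_le_sum fun k hk => ?_
      rw [mem_Ico] at hk
      exact mul_le_mul_of_nonneg_left (ih _ (by omega)) (by positivity)
    linarith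

/-! ### Numerical estimates -/

theorem pow_le_exp_mul_descFactorial (n j : ℕ) (hj : j ≤ n) :
    (n : ℝ) ^ j ≤ Real.exp 1 ^ j * (n.descFactorial j : ℝ) := by
  induction n generalizing j with
  | zero => obtain rfl : j = 0 := by omega
            simp
  | succ n ih =>
    obtain _ | j := j
    · simp
    have hj : j ≤ n := by omega
    -- This is `(1 + 1 / n) ^ j ≤ e` for `j ≤ n`; each induction step thus uses up one factor `e`.
    have h1 : ((n + 1 : ℕ) : ℝ) ^ j ≤ Real.exp 1 * (n : ℝ) ^ j := by
      obtain rfl | hn := Nat.eq_zero_or_pos n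
      · obtain rfl : j = 0 := by omega
        simp
      have hn' : (0 : ℝ) < n := by exact_mod_cast hn
      have h2 : ((n : ℝ) + 1) ^ j = (1 + 1 / (n : ℝ)) ^ j * (n : ℝ) ^ j := by
        rw [← mul_pow]
        congr 1
        field_simp
      have h3 : (1 + 1 / (n : ℝ)) ^ j ≤ Real.exp 1 := by
        calc (1 + 1 / (n : ℝ)) ^ j ≤ (Real.exp (1 / n)) ^ j := by
              gcongr
              rw [add_comm]
              exact Real.add_one_le_exp _
          _ = Real.exp (j * (1 / n)) := by rw [← Real.exp_nat_mul]
          _ ≤ Real.exp 1 := by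
              gcongr
              rw [mul_one_div, div_le_one hn']
              exact_mod_cast hj
      push_cast
      rw [h2]
      gcongr
    rw [Nat.succ_descFactorial_succ, pow_succ, pow_succ]
    calc ((n + 1 : ℕ) : ℝ) ^ j * ((n + 1 : ℕ) : ℝ) ≤
          Real.exp 1 * (Real.exp 1 ^ j * (n.descFactorial j : ℝ)) * ((n + 1 : ℕ) : ℝ) := by
          gcongr
          exact h1.trans (mul_le_mul_of_nonneg_left (ih j hj) (by positivity))
      _ = _ := by push_cast; ring

/-- The ratio `(n / e) ^ j / (n (n - 1) ⋯ (n - j + 1))`. -/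
noncomputable def fallingRatio (n j : ℕ) : ℝ :=
  (n / Real.exp 1) ^ j / (n.descFactorial j : ℝ)

theorem fallingRatio_nonneg (n j : ℕ) : 0 ≤ fallingRatio n j := by
  unfold fallingRatio
  positivity

theorem fallingRatio_le_one {n j : ℕ} (hj : j ≤ n) : fallingRatio n j ≤ 1 := by
  have h : (0 : ℝ) < (n.descFactorial j : ℝ) := by
    exact_mod_cast Nat.descFactorial_pos.2 hj
  rw [fallingRatio, div_le_one h, div_pow, div_le_iff₀ (by positivity), mul_comm]
  exact pow_le_exp_mul_descFactorial n j hj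

/-- The bound for the contribution of the maps with `j + 1` distinct values. -/
noncomputable def weightedRatio (n j : ℕ) : ℝ :=
  (25 / 8) ^ j / ((j + 1)! : ℝ) * fallingRatio n j

theorem weightedRatio_nonneg (n j : ℕ) : 0 ≤ weightedRatio n j :=
  mul_nonneg (by positivity) (fallingRatio_nonneg n j)

theorem weightedRatio_succ {n j : ℕ} (hj : j < n) :
    weightedRatio n (j + 1) =
      25 / 8 * n / (Real.exp 1 * (n - j) * (j + 2)) * weightedRatio n j := by
  have h : (0 : ℝ) < (n.descFactorial j : ℝ) := by
    exact_mod_cast Nat.descFactorial_pos.2 hj.le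
  have h2 : (0 : ℝ) < (n : ℝ) - j := sub_pos.2 (by exact_mod_cast hj)
  have h3 : (0 : ℝ) < ((j + 1)! : ℝ) := by positivity
  rw [weightedRatio, weightedRatio, fallingRatio, fallingRatio, Nat.descFactorial_succ,
    Nat.factorial_succ (j + 1), pow_succ ((n : ℝ) / Real.exp 1) j]
  generalize ((n : ℝ) / Real.exp 1) ^ j = x
  push_cast [Nat.cast_sub hj.le]
  field_simp
  ring

theorem weightedRatio_one_le {n : ℕ} (hn : 1 ≤ n) : weightedRatio n 1 ≤ 575 / 1000 := by
  have hn' : (0 : ℝ) < n := by exact_mod_cast hn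
  have he := Real.exp_one_gt_d9
  simp only [weightedRatio, fallingRatio, pow_one, Nat.descFactorial_one, Nat.factorial]
  have : (25 / 8 : ℝ) / ((((1 + 1) * ((0 + 1) * 1) : ℕ)) : ℝ) * (n / Real.exp 1 / n) =
      25 / 16 / Real.exp 1 := by
    field_simp
    norm_num
  rw [this, div_le_iff₀ (by positivity)]
  linarith

/-- Backward induction over the tail sums, whose terms decrease geometrically. -/
theorem sum_weightedRatio_le {n : ℕ} (hn : 19 ≤ n) :
    ∑ j ∈ Ico 1 n, weightedRatio n j ≤ 1 := by
  have he := Real.exp_one_gt_d9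
  have hlast : weightedRatio n (n - 1) ≤ 7 / 10 * weightedRatio n (n - 2) := by
    obtain ⟨t, rfl⟩ := Nat.exists_eq_add_of_le' hn
    rw [show t + 19 - 1 = t + 17 + 1 by omega, show t + 19 - 2 = t + 17 by omega,
      weightedRatio_succ (by omega)]
    refine mul_le_mul_of_nonneg_right ?_ (weightedRatio_nonneg _ _)
    push_cast
    have ht : (0 : ℝ) ≤ t := by positivity
    rw [show ((t : ℝ) + 19 - (t + 17)) = 2 by ring, div_le_iff₀ (by positivity)]
    nlinarith
  -- On `1 ≤ j ≤ n - 3` the concave product `(n - j)(j + 2)` is smallest at the ends, with value `3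
  -- (n - 1)`. The ratio is then at most `25 n / (24 e (n - 1))`, which is below `0.405` from `n =
  -- 19` on.
  have hstep : ∀ j, 1 ≤ j → j + 1 < n - 1 →
      weightedRatio n (j + 1) ≤ 405 / 1000 * weightedRatio n j := by
    intro j hj hjn
    rw [weightedRatio_succ (by omega)]
    refine mul_le_mul_of_nonneg_right ?_ (weightedRatio_nonneg _ _)
    have h1 : (1 : ℝ) ≤ j := by exact_mod_cast hj
    have h2 : (j : ℝ) + 3 ≤ n := by exact_mod_cast (show j + 3 ≤ n by omega)
    have h3 : (19 : ℝ) ≤ n := by exact_mod_cast hn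
    have h4 : 3 * ((n : ℝ) - 1) ≤ (n - j) * (j + 2) := by nlinarith
    rw [div_le_iff₀ (mul_pos (mul_pos (by positivity) (by linarith)) (by positivity))]
    have h5 : (2.7182818283 : ℝ) * (3 * ((n : ℝ) - 1)) ≤
        Real.exp 1 * ((n - j) * (j + 2)) := by
      gcongr
      linarith
    linarith
  -- The constant `1.7` covers the last two terms, `1 + 0.7`, and is preserved by the recursion as
  -- `1 + 0.405 * 1.7 < 1.7`. The total is then at most `1.7 * 0.575 < 1`.
  have htail : ∀ d j, 1 ≤ j → j + d + 2 = n →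
      ∑ i ∈ Ico j n, weightedRatio n i ≤ 17 / 10 * weightedRatio n j := by
    intro d
    induction d with
    | zero =>
      intro j hj hjn
      obtain rfl : n = j + 2 := by omega
      rw [sum_Ico_succ_top (by omega), sum_Ico_succ_top (by omega), Ico_self, sum_empty]
      have : weightedRatio (j + 2) (j + 1) ≤ 7 / 10 * weightedRatio (j + 2) j := hlast
      linarith
    | succ d ih =>
      intro j hj hjn
      rw [sum_eq_sum_Ico_succ_bot (by omega)]
      have h1 := ih (j + 1) (by omega) (by omega)
      have h2 := hstep j hj (by omega)
      have h3 := weightedRatio_nonneg n j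
      linarith
  have h1 := htail (n - 3) 1 le_rfl (by omega)
  have h2 := weightedRatio_one_le (n := n) (by omega)
  linarith

theorem compositionBound_le {s q n : ℕ} (hs : 1 ≤ s) (hn : 19 ≤ n)
    (hq : (q : ℝ) ≤ (n / Real.exp 1) ^ s) :
    compositionBound s q n / (n ! : ℝ) ^ s ≤ q + q ^ 2 * (Real.exp 1 / n) ^ s := by
  have hn' : (0 : ℝ) < n := by exact_mod_cast (show 0 < n by omega)
  have hnf : (0 : ℝ) < (n ! : ℝ) := by positivity
  rw [compositionBound, range_eq_Ico, sum_eq_sum_Ico_succ_bot (by omega), add_div]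
  simp only [zero_add, Nat.choose_one_right, pow_zero, mul_one, Nat.sub_zero]
  rw [mul_div_assoc, div_self (by positivity), mul_one]
  gcongr
  rw [sum_div]
  calc ∑ j ∈ Ico 1 n, (q.choose (j + 1) : ℝ) * (25 / 8) ^ j * ((n - j)! : ℝ) ^ s / (n ! : ℝ) ^ s
      ≤ ∑ j ∈ Ico 1 n, q ^ 2 * (Real.exp 1 / n) ^ s * weightedRatio n j := by
        refine sum_le_sum fun j hj => ?_
        rw [mem_Ico] at hj
        have hd : (0 : ℝ) < (n.descFactorial j : ℝ) := by
          exact_mod_cast Nat.descFactorial_pos.2 hj.2.le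
        have h1 : (n ! : ℝ) = ((n - j)! : ℝ) * (n.descFactorial j : ℝ) := by
          exact_mod_cast (Nat.factorial_mul_descFactorial hj.2.le).symm
        have h2 : ((n - j)! : ℝ) ^ s / (n ! : ℝ) ^ s = 1 / (n.descFactorial j : ℝ) ^ s := by
          rw [h1, mul_pow]
          field_simp
        have h3 : (q.choose (j + 1) : ℝ) ≤ (q : ℝ) ^ (j + 1) / ((j + 1)! : ℝ) :=
          Nat.choose_le_pow_div _ _
        obtain ⟨i, rfl⟩ := Nat.exists_eq_add_of_le' hj.1
        -- The assumption on `q` trades all but two factors `q` for powers of `(n / e) ^ s`, to be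
        -- cancelled by the falling factorial.
        have h4 : (q : ℝ) ^ (i + 1 + 1) ≤ q ^ 2 * ((n / Real.exp 1) ^ s) ^ i := by
          rw [show i + 1 + 1 = 2 + i by ring, pow_add]
          gcongr
        have h5 : (n / Real.exp 1) ^ (s * (i + 1)) / (n.descFactorial (i + 1) : ℝ) ^ s ≤
            fallingRatio n (i + 1) := by
          rw [mul_comm s, pow_mul, ← div_pow]
          exact pow_le_of_le_one (fallingRatio_nonneg _ _) (fallingRatio_le_one hj.2.le)
            (by omega)
        rw [mul_div_assoc, h2, weightedRatio]
        calc (q.choose (i + 1 + 1) : ℝ) * (25 / 8) ^ (i + 1) *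
              (1 / (n.descFactorial (i + 1) : ℝ) ^ s) ≤
              (q ^ 2 * ((n / Real.exp 1) ^ s) ^ i / ((i + 1 + 1)! : ℝ)) * (25 / 8) ^ (i + 1) *
              (1 / (n.descFactorial (i + 1) : ℝ) ^ s) := by
              gcongr
              exact h3.trans (by gcongr)
          _ = q ^ 2 * (Real.exp 1 / n) ^ s * ((25 / 8) ^ (i + 1) / ((i + 1 + 1)! : ℝ) *
              ((n / Real.exp 1) ^ (s * (i + 1)) / (n.descFactorial (i + 1) : ℝ) ^ s)) := by
              have : (Real.exp 1 / n) ^ s * (n / Real.exp 1) ^ s = 1 := by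
                rw [← mul_pow]
                field_simp
                simp
              rw [Nat.mul_succ, pow_add _ (s * i) s, pow_mul _ s i]
              linear_combination (-(q : ℝ) ^ 2 * ((n / Real.exp 1) ^ s) ^ i / ((i + 1 + 1)! : ℝ) *
                (25 / 8) ^ (i + 1) * (1 / (n.descFactorial (i + 1) : ℝ) ^ s)) * this
          _ ≤ _ := by gcongr
    _ = q ^ 2 * (Real.exp 1 / n) ^ s * ∑ j ∈ Ico 1 n, weightedRatio n j := by rw [mul_sum]
    _ ≤ _ := mul_le_of_le_one_right (by positivity) (sum_weightedRatio_le hn)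

/-! ### Permutations preserving a map -/

section Stabilizer

variable {G : Type*} [Fintype G] [DecidableEq G] {n : ℕ}

/-- The number of indices at which `f` takes the value `c`. -/
def fiberCard (f : Fin n → G) (c : G) : ℕ := #{i | f i = c}

/-- Compare the coefficients of the monomial `X ^ k` in two expansions of `(∑ c, X c) ^ n`: over all
maps, and by the multinomial theorem. -/
theorem card_fiberCard_eq (k : G → ℕ) (hk : ∑ c, k c = n) :
    #{f : Fin n → G | fiberCard f = k} = Nat.multinomial univ k := by
  have h1 : (∑ c : G, (MvPolynomial.X c : MvPolynomial G ℕ)) ^ n =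
      ∑ f : Fin n → G, ∏ c, MvPolynomial.X c ^ fiberCard f c := by
    have := prod_univ_sum (fun _ : Fin n => (univ : Finset G))
      (fun _ c => (MvPolynomial.X c : MvPolynomial G ℕ))
    rw [prod_const, card_univ, Fintype.card_fin, Fintype.piFinset_univ] at this
    rw [this]
    refine sum_congr rfl fun f _ => ?_
    rw [← prod_fiberwise_of_maps_to (fun i _ => mem_univ (f i))]
    refine prod_congr rfl fun c _ => ?_
    rw [prod_congr rfl (g := fun _ => MvPolynomial.X c)
      (fun i hi => by rw [(mem_filter.1 hi).2]), prod_const, fiberCard]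
  rw [sum_pow_eq_sum_piAntidiag] at h1
  have hmon : ∀ l : G → ℕ, ∏ c, (MvPolynomial.X c : MvPolynomial G ℕ) ^ l c =
      MvPolynomial.monomial (Finsupp.equivFunOnFinite.symm l) 1 := by
    intro l
    rw [MvPolynomial.monomial_eq, map_one, one_mul, Finsupp.prod_fintype _ _ (by simp)]
    simp
  have h2 := congrArg (MvPolynomial.coeff (Finsupp.equivFunOnFinite.symm k)) h1
  simp only [hmon, MvPolynomial.coeff_sum, ← map_natCast (MvPolynomial.C (σ := G) (R := ℕ)),
    MvPolynomial.coeff_C_mul, MvPolynomial.coeff_monomial, EmbeddingLike.apply_eq_iff_eq,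
    mul_ite, mul_one, mul_zero, sum_ite_eq', mem_piAntidiag, hk] at h2
  rw [card_filter]
  simpa using h2.symm

theorem card_perm_preserving (f : Fin n → G) :
    #{σ : Equiv.Perm (Fin n) | f ∘ σ = f} = ∏ c, (fiberCard f c)! := by
  rw [← Fintype.card_subtype, DomMulAct.stabilizer_card]
  refine prod_congr rfl fun c _ => ?_
  rw [Fintype.card_subtype, fiberCard]

theorem sum_prod_fiberCard_factorial (s : ℕ) :
    ∑ f : Fin n → G, ((∏ c, (fiberCard f c)! : ℕ) : ℝ) ^ (s + 1) =
      (n ! : ℝ) * ∑ k ∈ piAntidiag (univ : Finset G) n, ∏ c, ((k c)! : ℝ) ^ s := by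
  have hmaps : ∀ f ∈ (univ : Finset (Fin n → G)), fiberCard f ∈ piAntidiag (univ : Finset G) n := by
    intro f _
    rw [mem_piAntidiag]
    refine ⟨?_, fun _ _ => mem_univ _⟩
    have := card_eq_sum_card_fiberwise (f := f) (s := univ) (t := univ) (by simp)
    rw [card_univ, Fintype.card_fin] at this
    exact this.symm
  rw [← sum_fiberwise_of_maps_to hmaps, mul_sum]
  refine sum_congr rfl fun k hk => ?_
  rw [mem_piAntidiag] at hk
  rw [sum_congr rfl (g := fun _ => ((∏ c, (k c)! : ℕ) : ℝ) ^ (s + 1))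
    (fun f hf => by rw [(mem_filter.1 hf).2]), sum_const, card_fiberCard_eq k hk.1, nsmul_eq_mul,
    pow_succ]
  have h := Nat.multinomial_spec univ k
  rw [hk.1] at h
  rw [← h, prod_pow]
  push_cast
  ring

end Stabilizer

/-! ### The mass function of the view -/

section View

variable {G : Type*} {m n : ℕ}

theorem shuffler_apply [DecidableEq G] (y z : Fin n → G) :
    shuffler y z = ∑ π : Equiv.Perm (Fin n), if z = y ∘ π then (n ! : ℝ≥0∞)⁻¹ else 0 := by
  simp [shuffler, PMF.map_apply, tsum_fintype, Fintype.card_perm]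

variable [AddCommGroup G]

/-- The last messages are determined by the shuffled ones once the shuffles `π` are given. -/
def shuffledSum (π : Fin m → Equiv.Perm (Fin n)) (z : Fin m → Fin n → G) (i : Fin n) : G :=
  ∑ j, z j ((π j).symm i)

variable [Fintype G] [DecidableEq G]

theorem additiveShares_apply (k : ℕ) [NeZero k] (x : G) (y : Fin k → G) :
    additiveShares k x y = if ∑ j, y j = x then (#(shareSet k x) : ℝ≥0∞)⁻¹ else 0 := by
  split_ifs with h
  · exact PMF.uniformOfFinset_apply_of_mem _ (by simp [shareSet, h])
  · exact PMF.uniformOfFinset_apply_of_notMem _ (by simp [shareSet, h])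

/-- The shuffles for which `v` can be the view on the input `x`. -/
def consistentShuffles (x : Fin n → G) (v : Fin (m + 1) → Fin n → G) :
    Finset (Fin m → Equiv.Perm (Fin n)) :=
  univ.filter fun π => shuffledSum π (Fin.init v) + v (Fin.last m) = x

/-- Given `v` and `π`, a single share matrix `Y` is possible, and its validity is exactly
consistency of `π`. Every consistent `π` has the same weight, so the constant can stay implicit
until the total mass fixes it. -/
theorem exists_ikosRandomizedInputs_apply (x : Fin n → G) :
    ∃ c : ℝ≥0∞, ∀ v, ikosRandomizedInputs m n x v = c * #(consistentShuffles x v) := by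
  refine ⟨(∏ i, (#(shareSet (m + 1) (x i)) : ℝ≥0∞)⁻¹) * ∏ _j : Fin m, (n ! : ℝ≥0∞)⁻¹,
    fun v => ?_⟩
  have hshares : ∀ Y : Fin n → Fin (m + 1) → G,
      indep (fun i => additiveShares (m + 1) (x i)) Y =
        if ∀ i, ∑ j, Y i j = x i then ∏ i, (#(shareSet (m + 1) (x i)) : ℝ≥0∞)⁻¹ else 0 := by
    intro Y
    simp only [indep, PMF.ofFintype_apply, additiveShares_apply]
    split_ifs with h
    · exact prod_congr rfl fun i _ => if_pos (h i)
    · obtain ⟨i, hi⟩ := not_forall.1 h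
      exact prod_eq_zero (mem_univ i) (if_neg hi)
  have hshuffle : ∀ Y : Fin n → Fin (m + 1) → G,
      (indep fun j : Fin m => shuffler fun i => Y i j.castSucc) (Fin.init v) =
        ∑ π : Fin m → Equiv.Perm (Fin n),
          if ∀ j, Fin.init v j = (fun i => Y i j.castSucc) ∘ π j
          then ∏ _j : Fin m, (n ! : ℝ≥0∞)⁻¹ else 0 := by
    intro Y
    simp only [indep, PMF.ofFintype_apply, shuffler_apply]
    rw [prod_univ_sum, Fintype.piFinset_univ]
    simp only [prod_ite_zero, mem_univ, true_implies]
  have hmap : ∀ Y : Fin n → Fin (m + 1) → G,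
      ((indep fun j : Fin m => shuffler fun i => Y i j.castSucc).map fun Z =>
        Fin.snoc (α := fun _ => Fin n → G) Z fun i => Y i (Fin.last m)) v =
      if v (Fin.last m) = (fun i => Y i (Fin.last m)) then
        (indep fun j : Fin m => shuffler fun i => Y i j.castSucc) (Fin.init v) else 0 := by
    intro Y
    rw [PMF.map_apply, tsum_fintype]
    have : ∀ Z : Fin m → Fin n → G,
        (v = Fin.snoc (α := fun _ => Fin n → G) Z fun i => Y i (Fin.last m)) ↔
          Z = Fin.init v ∧ v (Fin.last m) = (fun i => Y i (Fin.last m)) := by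
      intro Z
      constructor
      · rintro rfl
        simp
      · rintro ⟨rfl, h⟩
        rw [← h, Fin.snoc_init_self]
    simp only [this, ite_and, sum_ite_eq', mem_univ, if_true]
  rw [ikosRandomizedInputs, PMF.bind_apply, tsum_fintype]
  simp only [hshares, hmap, hshuffle]
  calc _ = ∑ Y : Fin n → Fin (m + 1) → G, ∑ π : Fin m → Equiv.Perm (Fin n),
        if Y = (fun i => Fin.snoc (α := fun _ => G) (fun j => v j.castSucc ((π j).symm i))
            (v (Fin.last m) i)) ∧ π ∈ consistentShuffles x v
        then (∏ i, (#(shareSet (m + 1) (x i)) : ℝ≥0∞)⁻¹) * ∏ _j : Fin m, (n ! : ℝ≥0∞)⁻¹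
        else 0 := by
        refine sum_congr rfl fun Y _ => ?_
        have hmul : ∀ (a b : Prop) [Decidable a] [Decidable b]
            (c : (Fin m → Equiv.Perm (Fin n)) → Prop) [DecidablePred c] (p r : ℝ≥0∞),
            (if a then p else 0) * (if b then ∑ π, if c π then r else 0 else 0) =
              ∑ π, if a ∧ b ∧ c π then p * r else 0 := by
          intro a b _ _ c _ p r
          by_cases ha : a <;> by_cases hb : b <;> simp [ha, hb, mul_sum]
        rw [hmul]
        refine sum_congr rfl fun π _ => if_congr ?_ rfl rfl
        simp only [consistentShuffles, mem_filter, mem_univ, true_and]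
        constructor
        · rintro ⟨h1, h2, h3⟩
          have h4 : ∀ i j, Y i (Fin.castSucc j) = v j.castSucc ((π j).symm i) := by
            intro i j
            have := congrFun (h3 j) ((π j).symm i)
            simpa [Fin.init] using this.symm
          refine ⟨?_, ?_⟩
          · funext i j
            refine Fin.lastCases ?_ (fun j => ?_) j
            · simp [h2]
            · simp [h4]
          · funext i
            rw [← h1 i, Fin.sum_univ_castSucc, Pi.add_apply, h2]
            simp [h4, shuffledSum, Fin.init]
        · rintro ⟨rfl, h⟩
          refine ⟨fun i => ?_, by simp, fun j => ?_⟩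
          · rw [← h, Fin.sum_univ_castSucc]
            simp [shuffledSum, Fin.init]
          · funext i
            simp [Fin.init]
    _ = ∑ π : Fin m → Equiv.Perm (Fin n), if π ∈ consistentShuffles x v
        then (∏ i, (#(shareSet (m + 1) (x i)) : ℝ≥0∞)⁻¹) * ∏ _j : Fin m, (n ! : ℝ≥0∞)⁻¹
        else 0 := by
        rw [sum_comm]
        refine sum_congr rfl fun π _ => ?_
        simp only [ite_and, sum_ite_eq', mem_univ, if_true]
    _ = _ := by
        rw [sum_ite_mem, univ_inter, sum_const, nsmul_eq_mul, mul_comm]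

end View

/-! ### Exact summation and the normalization of the view -/

section Normalization

variable {G : Type*} [AddCommGroup G] {m n : ℕ}

theorem sum_shuffledSum (π : Fin m → Equiv.Perm (Fin n)) (z : Fin m → Fin n → G) :
    ∑ i, shuffledSum π z i = ∑ j, ∑ i, z j i := by
  simp only [shuffledSum]
  rw [sum_comm]
  exact sum_congr rfl fun j _ => Equiv.sum_comp (π j).symm (z j)

theorem sumAnalyzer_eq_of_shuffledSum {x : Fin n → G} {v : Fin (m + 1) → Fin n → G}
    {π : Fin m → Equiv.Perm (Fin n)} (h : shuffledSum π (Fin.init v) + v (Fin.last m) = x) :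
    sumAnalyzer (m + 1) n v = ∑ i, x i := by
  rw [← h, sumAnalyzer, Fin.sum_univ_castSucc]
  simp only [Pi.add_apply, sum_add_distrib, sum_shuffledSum, Fin.init]

variable [Fintype G] [DecidableEq G]

theorem sumAnalyzer_eq_of_mem_support {x : Fin n → G} {v : Fin (m + 1) → Fin n → G}
    (h : ikosRandomizedInputs m n x v ≠ 0) : sumAnalyzer (m + 1) n v = ∑ i, x i := by
  obtain ⟨c, hc⟩ := exists_ikosRandomizedInputs_apply (m := m) x
  have hne : (consistentShuffles x v).Nonempty := by
    rw [nonempty_iff_ne_empty]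
    intro he
    rw [hc, he] at h
    simp at h
  obtain ⟨π, hπ⟩ := hne
  exact sumAnalyzer_eq_of_shuffledSum (mem_filter.1 hπ).2

theorem computesExactSummation_ikosRandomizedInputs :
    ComputesExactSummation (ikosRandomizedInputs (G := G) m n) (sumAnalyzer (m + 1) n) := by
  intro x
  have h : (ikosRandomizedInputs m n x).map (sumAnalyzer (m + 1) n) =
      (ikosRandomizedInputs m n x).map (Function.const _ (∑ i, x i)) := by
    ext b
    simp only [PMF.map_apply]
    refine tsum_congr fun v => ?_
    by_cases hv : ikosRandomizedInputs m n x v = 0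
    · simp [hv]
    · rw [sumAnalyzer_eq_of_mem_support hv, Function.const_apply]
  rw [h, PMF.map_const]

theorem sum_init_last {X M : Type*} [Fintype X] [AddCommMonoid M] (F : (Fin m → X) → X → M) :
    ∑ v : Fin (m + 1) → X, F (Fin.init v) (v (Fin.last m)) = ∑ z, ∑ w, F z w := by
  rw [← Equiv.sum_comp (Fin.snocEquiv fun _ : Fin (m + 1) => X), Fintype.sum_prod_type_right]
  simp [Fin.snocEquiv]

theorem sum_card_consistentShuffles (x : Fin n → G) :
    ∑ v : Fin (m + 1) → Fin n → G, (#(consistentShuffles x v) : ℝ) =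
      (Fintype.card G : ℝ) ^ (n * m) * (n ! : ℝ) ^ m := by
  simp only [consistentShuffles, card_filter, Nat.cast_sum]
  rw [sum_init_last (m := m) (fun (z : Fin m → Fin n → G) w =>
    ∑ π, (((if shuffledSum π z + w = x then 1 else 0 : ℕ)) : ℝ))]
  have : ∀ (π : Fin m → Equiv.Perm (Fin n)) (z : Fin m → Fin n → G),
      ∑ w, (((if shuffledSum π z + w = x then 1 else 0 : ℕ)) : ℝ) = 1 := by
    intro π z
    simp only [← eq_sub_iff_add_eq']
    simp
  simp_rw [sum_comm (s := (univ : Finset (Fin n → G))), this]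
  simp [Fintype.card_perm, pow_mul]

theorem sum_toReal_eq_one {α : Type*} [Fintype α] (p : PMF α) : ∑ a, (p a).toReal = 1 := by
  have h := p.tsum_coe
  rw [tsum_fintype] at h
  rw [← ENNReal.toReal_sum fun v _ => PMF.apply_ne_top _ _, h, ENNReal.toReal_one]

theorem toReal_ikosRandomizedInputs_apply (x : Fin n → G) (v : Fin (m + 1) → Fin n → G) :
    (ikosRandomizedInputs m n x v).toReal =
      #(consistentShuffles x v) / ((Fintype.card G : ℝ) ^ (n * m) * (n ! : ℝ) ^ m) := by
  obtain ⟨c, hc⟩ := exists_ikosRandomizedInputs_apply (m := m) x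
  have h1 := sum_toReal_eq_one (ikosRandomizedInputs m n x)
  simp only [hc, ENNReal.toReal_mul, ENNReal.toReal_natCast] at h1 ⊢
  rw [← mul_sum, sum_card_consistentShuffles] at h1
  have hpos : (0 : ℝ) < (Fintype.card G : ℝ) ^ (n * m) * (n ! : ℝ) ^ m := by
    have : 0 < Fintype.card G := Fintype.card_pos
    positivity
  rw [eq_div_iff hpos.ne', mul_right_comm, h1, one_mul]

/-- Adding `g` to one message shifts the sum by `g`, so the translates of the set by the elements of
the group are disjoint. -/
theorem card_sumAnalyzer_eq_mul_card_le (hn : 0 < n) (t : G) :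
    #{v : Fin (m + 1) → Fin n → G | sumAnalyzer (m + 1) n v = t} * Fintype.card G ≤
      Fintype.card G ^ (n * (m + 1)) := by
  have hcard : Fintype.card G ^ (n * (m + 1)) = #(univ : Finset (Fin (m + 1) → Fin n → G)) := by
    simp [pow_mul]
  rw [hcard, ← card_univ, ← card_product]
  have hadd : ∀ (v : Fin (m + 1) → Fin n → G) (g : G),
      sumAnalyzer (m + 1) n (v + Pi.single 0 (Pi.single ⟨0, hn⟩ g)) =
        sumAnalyzer (m + 1) n v + g := by
    intro v g
    simp only [sumAnalyzer, Pi.add_apply, sum_add_distrib]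
    congr 1
    rw [Fintype.sum_eq_single 0 (fun j hj => by simp [hj])]
    simp
  refine card_le_card_of_injOn (fun p => p.1 + Pi.single 0 (Pi.single ⟨0, hn⟩ p.2))
    (fun _ _ => mem_coe.2 (mem_univ _)) ?_
  rintro ⟨v, g⟩ hv ⟨v', g'⟩ hv' h
  simp only [coe_product, coe_filter, mem_univ, true_and, Set.mem_prod, Set.mem_ofPred_eq] at hv hv' h
  have hg : g = g' := by
    have := congrArg (sumAnalyzer (m + 1) n) h
    rw [hadd, hadd, hv.1, hv'.1] at this
    exact add_left_cancel this
  subst hg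
  exact Prod.ext (add_right_cancel h) rfl

end Normalization

/-! ### Total variation distance -/

section TotalVariation

variable {α : Type*} [Fintype α]

theorem tvDist_le_one (p r : PMF α) : tvDist p r ≤ 1 := by
  rw [tvDist, tsum_fintype]
  have : ∑ a, |(p a).toReal - (r a).toReal| ≤ ∑ a, ((p a).toReal + (r a).toReal) := by
    refine sum_le_sum fun a _ => (abs_sub _ _).trans (le_of_eq ?_)
    rw [abs_of_nonneg ENNReal.toReal_nonneg, abs_of_nonneg ENNReal.toReal_nonneg]
  rw [sum_add_distrib, sum_toReal_eq_one, sum_toReal_eq_one] at this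
  linarith

theorem sum_abs_sub_inv_card_le {p : PMF α} {S : Finset α} (hp : ∀ a, p a ≠ 0 → a ∈ S) {B : ℝ}
    (hB : 0 ≤ B) (h : #S * ∑ a, (p a).toReal ^ 2 ≤ 1 + B ^ 2) :
    ∑ a ∈ S, |(p a).toReal - (#S : ℝ)⁻¹| ≤ B := by
  have hsub : ∀ a ∈ univ, a ∉ S → (p a).toReal = 0 := by
    intro a _ ha
    rw [not_imp_comm.1 (hp a) ha, ENNReal.toReal_zero]
  have h1 : ∑ a ∈ S, (p a).toReal = 1 := by
    rw [sum_subset (subset_univ S) hsub, sum_toReal_eq_one]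
  have h2 : ∑ a ∈ S, (p a).toReal ^ 2 = ∑ a, (p a).toReal ^ 2 :=
    sum_subset (subset_univ S) fun a ha ha' => by rw [hsub a ha ha']; simp
  have hS : (#S : ℝ) ≠ 0 := by
    intro h0
    rw [Nat.cast_eq_zero, card_eq_zero] at h0
    simp [h0] at h1
  -- Cauchy–Schwarz: the square of the `ℓ¹` distance to uniform is at most `#S * ∑ (p a - 1 / #S) ^
  -- 2 = #S * ∑ (p a) ^ 2 - 1`.
  refine abs_le_of_sq_le_sq' ?_ hB |>.2
  refine sq_sum_le_card_mul_sum_sq.trans ?_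
  simp only [sq_abs, sub_sq, sum_add_distrib, sum_sub_distrib, ← sum_mul, ← mul_sum, h1, h2,
    sum_const, nsmul_eq_mul]
  have : (#S : ℝ) * (∑ a, (p a).toReal ^ 2 - 2 * 1 * (#S : ℝ)⁻¹ + #S * (#S : ℝ)⁻¹ ^ 2) =
      #S * ∑ a, (p a).toReal ^ 2 - 1 := by
    field_simp
    ring
  linarith

/-- Two distributions on `S` of small collision probability are close to the uniform one. -/
theorem tvDist_le_of_collision {p r : PMF α} {S : Finset α} (hp : ∀ a, p a ≠ 0 → a ∈ S)
    (hr : ∀ a, r a ≠ 0 → a ∈ S) {B : ℝ} (hB : 0 ≤ B)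
    (hp2 : #S * ∑ a, (p a).toReal ^ 2 ≤ 1 + B ^ 2)
    (hr2 : #S * ∑ a, (r a).toReal ^ 2 ≤ 1 + B ^ 2) : tvDist p r ≤ B := by
  rw [tvDist, tsum_fintype]
  have h1 := sum_abs_sub_inv_card_le hp hB hp2
  have h2 := sum_abs_sub_inv_card_le hr hB hr2
  have h3 : ∑ a, |(p a).toReal - (r a).toReal| =
      ∑ a ∈ S, |(p a).toReal - (r a).toReal| := by
    refine (sum_subset (subset_univ S) fun a _ ha => ?_).symm
    rw [not_imp_comm.1 (hp a) ha, not_imp_comm.1 (hr a) ha]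
    simp
  have h4 : ∑ a ∈ S, |(p a).toReal - (r a).toReal| ≤
      ∑ a ∈ S, (|(p a).toReal - (#S : ℝ)⁻¹| + |(r a).toReal - (#S : ℝ)⁻¹|) := by
    refine sum_le_sum fun a _ => ?_
    rw [abs_sub_comm (r a).toReal]
    exact abs_sub_le _ _ _
  rw [sum_add_distrib] at h4
  linarith

end TotalVariation

/-! ### Counting collisions with additive characters -/

section Collision

theorem addChar_map_sum {ι A M : Type*} [AddCommMonoid A] [CommMonoid M] (ψ : AddChar A M)
    (s : Finset ι) (f : ι → A) : ψ (∑ i ∈ s, f i) = ∏ i ∈ s, ψ (f i) := by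
  induction s using Finset.cons_induction with
  | empty => simp
  | cons i s hi ih => rw [sum_cons, prod_cons, AddChar.map_add_eq_mul, ih]

theorem card_perm_comp_eq {G : Type*} [DecidableEq G] {n : ℕ} (f : Fin n → G) :
    ∑ σ : Equiv.Perm (Fin n), ∑ τ : Equiv.Perm (Fin n), (if f ∘ σ = f ∘ τ then 1 else 0 : ℕ) =
      n ! * #{σ : Equiv.Perm (Fin n) | f ∘ σ = f} := by
  rw [sum_comm]
  have : ∀ τ : Equiv.Perm (Fin n), ∑ σ : Equiv.Perm (Fin n), (if f ∘ σ = f ∘ τ then 1 else 0 : ℕ) =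
      #{σ : Equiv.Perm (Fin n) | f ∘ σ = f} := by
    intro τ
    rw [← Equiv.sum_comp (Equiv.mulRight τ), card_filter]
    refine sum_congr rfl fun σ _ => if_congr ?_ rfl rfl
    rw [Equiv.coe_mulRight, Equiv.Perm.coe_mul, ← Function.comp_assoc]
    exact τ.surjective.injective_comp_right.eq_iff
  simp [this, Fintype.card_perm]

variable {q m n : ℕ}

theorem sum_mul_shuffledSum (f : Fin n → ZMod q) (π : Fin m → Equiv.Perm (Fin n))
    (z : Fin m → Fin n → ZMod q) :
    ∑ i, f i * shuffledSum π z i = ∑ j, ∑ a, z j a * f (π j a) := by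
  simp only [shuffledSum, mul_sum]
  rw [sum_comm]
  refine sum_congr rfl fun j _ => ?_
  rw [← Equiv.sum_comp (π j)]
  exact sum_congr rfl fun a _ => by rw [Equiv.symm_apply_apply, mul_comm]

variable [NeZero q]

theorem sum_prod_stdAddChar (u : Fin n → ZMod q) :
    ∑ f : Fin n → ZMod q, ∏ i, ZMod.stdAddChar (f i * u i) =
      if u = 0 then (q : ℂ) ^ n else 0 := by
  have h := prod_univ_sum (fun _ : Fin n => (univ : Finset (ZMod q)))
    (fun i a => ZMod.stdAddChar (a * u i))
  rw [Fintype.piFinset_univ] at h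
  rw [← h]
  simp only [AddChar.sum_mulShift _ (ZMod.isPrimitive_stdAddChar q), ZMod.card]
  push_cast
  split_ifs with hu
  · simp [hu]
  · obtain ⟨i, hi⟩ := Function.ne_iff.1 hu
    exact prod_eq_zero (mem_univ i) (if_neg hi)

/-- Duality between a linear map and its transpose: `z ↦ shuffledSum π z - shuffledSum τ z` has
transpose `f ↦ (f ∘ π j - f ∘ τ j)_j`. Expanding the equality in characters indexed by `f` and then
summing over `z` compares the two kernels. -/
theorem card_shuffledSum_eq (π τ : Fin m → Equiv.Perm (Fin n)) :
    (q : ℂ) ^ n * ∑ z : Fin m → Fin n → ZMod q,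
        (if shuffledSum π z = shuffledSum τ z then 1 else 0) =
      (q : ℂ) ^ (n * m) * ∑ f : Fin n → ZMod q,
        ∏ j, (if f ∘ π j = f ∘ τ j then 1 else 0) := by
  have h1 : ∀ z : Fin m → Fin n → ZMod q,
      (q : ℂ) ^ n * (if shuffledSum π z = shuffledSum τ z then 1 else 0) =
        ∑ f : Fin n → ZMod q, ∏ j, ∏ a, ZMod.stdAddChar (z j a * (f ∘ π j - f ∘ τ j) a) := by
    intro z
    have := sum_prod_stdAddChar (shuffledSum π z - shuffledSum τ z)
    rw [mul_ite, mul_one, mul_zero, ← if_congr sub_eq_zero rfl rfl, ← this]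
    refine sum_congr rfl fun f _ => ?_
    simp only [← addChar_map_sum]
    congr 1
    simp only [Pi.sub_apply, mul_sub, sum_sub_distrib, sum_mul_shuffledSum, Function.comp_apply]
  rw [mul_sum, sum_congr rfl fun z _ => h1 z, sum_comm, mul_sum]
  refine sum_congr rfl fun f _ => ?_
  have h2 := prod_univ_sum (fun _ : Fin m => (univ : Finset (Fin n → ZMod q)))
    (fun j z => ∏ a, ZMod.stdAddChar (z a * (f ∘ π j - f ∘ τ j) a))
  rw [Fintype.piFinset_univ] at h2
  rw [← h2]
  simp only [sum_prod_stdAddChar, sub_eq_zero]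
  rw [pow_mul, ← Fin.prod_const m, ← prod_mul_distrib]
  simp

theorem sum_sum_prod_eq_pow {ι R : Type*} [Fintype ι] [DecidableEq ι] [CommSemiring R]
    (g : ι → ι → R) :
    ∑ π : Fin m → ι, ∑ τ : Fin m → ι, ∏ j, g (π j) (τ j) = (∑ a, ∑ b, g a b) ^ m := by
  have h1 : ∀ π : Fin m → ι, ∑ τ : Fin m → ι, ∏ j, g (π j) (τ j) = ∏ j, ∑ b, g (π j) b := by
    intro π
    rw [prod_univ_sum, Fintype.piFinset_univ]
  simp only [h1]
  rw [← Fin.prod_const, prod_univ_sum, Fintype.piFinset_univ]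

theorem sum_card_consistentShuffles_sq (x : Fin n → ZMod q) :
    (q : ℝ) ^ n * ∑ v : Fin (m + 1) → Fin n → ZMod q, (#(consistentShuffles x v) : ℝ) ^ 2 =
      (q : ℝ) ^ (n * m) * ∑ f : Fin n → ZMod q,
        ((n ! : ℝ) * ((∏ c, (fiberCard f c)! : ℕ) : ℝ)) ^ m := by
  -- The identity is proved over `ℂ`, where the characters live; both sides are natural numbers, so
  -- it transfers to `ℝ`.
  have key : (q : ℂ) ^ n * ∑ v : Fin (m + 1) → Fin n → ZMod q,
      (#(consistentShuffles x v) : ℂ) ^ 2 =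
      (q : ℂ) ^ (n * m) * ∑ f : Fin n → ZMod q,
        ((n ! : ℂ) * ((∏ c, (fiberCard f c)! : ℕ) : ℂ)) ^ m := by
    have h1 : ∑ v : Fin (m + 1) → Fin n → ZMod q, (#(consistentShuffles x v) : ℂ) ^ 2 =
        ∑ π : Fin m → Equiv.Perm (Fin n), ∑ τ : Fin m → Equiv.Perm (Fin n),
          ∑ z : Fin m → Fin n → ZMod q,
            (if shuffledSum π z = shuffledSum τ z then 1 else 0 : ℂ) := by
      have h2 : ∀ v : Fin (m + 1) → Fin n → ZMod q, (#(consistentShuffles x v) : ℂ) ^ 2 =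
          ∑ π : Fin m → Equiv.Perm (Fin n), ∑ τ : Fin m → Equiv.Perm (Fin n),
            (if v (Fin.last m) = x - shuffledSum π (Fin.init v) then
              (if shuffledSum π (Fin.init v) = shuffledSum τ (Fin.init v) then 1 else 0 : ℂ)
              else 0) := by
        intro v
        rw [consistentShuffles, card_filter, sq]
        push_cast
        rw [sum_mul_sum]
        refine sum_congr rfl fun π _ => sum_congr rfl fun τ _ => ?_
        by_cases h : v (Fin.last m) = x - shuffledSum π (Fin.init v)
        · rw [if_pos h, if_pos (eq_sub_iff_add_eq'.1 h), one_mul, h]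
          refine if_congr ?_ rfl rfl
          rw [← eq_sub_iff_add_eq', sub_right_inj]
        · rw [if_neg h, if_neg fun h' => h (eq_sub_iff_add_eq'.2 h'), zero_mul]
      simp only [h2]
      rw [sum_init_last (m := m) (fun (z : Fin m → Fin n → ZMod q) w => ∑ π, ∑ τ,
        (if w = x - shuffledSum π z then
          (if shuffledSum π z = shuffledSum τ z then 1 else 0 : ℂ) else 0))]
      simp_rw [sum_comm (s := (univ : Finset (Fin n → ZMod q)))]
      simp only [sum_ite_eq', mem_univ, if_true]
      simp_rw [sum_comm (s := (univ : Finset (Fin m → Fin n → ZMod q)))]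
    rw [h1, mul_sum]
    simp only [mul_sum (s := (univ : Finset (Fin m → Equiv.Perm (Fin n)))), card_shuffledSum_eq]
    simp only [← mul_sum]
    congr 1
    simp_rw [sum_comm (t := (univ : Finset (Fin n → ZMod q)))]
    refine sum_congr rfl fun f _ => ?_
    rw [sum_sum_prod_eq_pow (fun a b : Equiv.Perm (Fin n) => if f ∘ a = f ∘ b then (1 : ℂ) else 0)]
    congr 1
    have := card_perm_comp_eq f
    rw [card_perm_preserving] at this
    exact_mod_cast this
  exact_mod_cast key

end Collision

/-! ### Security -/

section Security

/-- The algebra of `card_mul_sum_sq_le`, with `C` the number of views of the right sum, `A` the sum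
of squared counts, `y = q ^ (n * m)`, `Q = q ^ n`, `F = n! ^ (m - 1)`, `f = n!` and `ε = (e / n) ^
(m - 1)`. -/
theorem mul_div_sq_le_of_bounds {C A T y Q F f q ε : ℝ} (hy : 0 < y) (hQ : 0 < Q) (hF : 0 < F)
    (hf : 0 < f) (hq : 0 < q) (hA0 : 0 ≤ A) (hC : C * q ≤ y * Q)
    (hA : Q * A = y * (F * f * (f * T))) (hT : T ≤ F * (q + q ^ 2 * ε)) :
    C * (A / (y * (F * f)) ^ 2) ≤ 1 + q * ε := by
  calc C * (A / (y * (F * f)) ^ 2) ≤ y * Q / q * (A / (y * (F * f)) ^ 2) := by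
        refine mul_le_mul_of_nonneg_right ?_ (by positivity)
        rwa [le_div_iff₀ hq]
    _ = Q * A * y / (q * (y * (F * f)) ^ 2) := by
        field_simp
    _ = T / (F * q) := by
        rw [hA]
        field_simp
    _ ≤ F * (q + q ^ 2 * ε) / (F * q) := by gcongr
    _ = _ := by field_simp

theorem card_mul_sum_sq_le {q m n : ℕ} [NeZero q] (hm : 2 ≤ m) (hn : 19 ≤ n)
    (hq : (q : ℝ) ≤ (n / Real.exp 1) ^ (m - 1)) (x : Fin n → ZMod q) :
    (#{v : Fin (m + 1) → Fin n → ZMod q | sumAnalyzer (m + 1) n v = ∑ i, x i} : ℝ) *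
        ∑ v, (ikosRandomizedInputs m n x v).toReal ^ 2 ≤
      1 + q * (Real.exp 1 / n) ^ (m - 1) := by
  obtain ⟨s, rfl⟩ : ∃ s, m = s + 1 := ⟨m - 1, by omega⟩
  rw [Nat.add_sub_cancel] at hq ⊢
  have hq0 : (0 : ℝ) < q := by exact_mod_cast Nat.pos_of_ne_zero (NeZero.ne q)
  have hnf : (0 : ℝ) < (n ! : ℝ) := by positivity
  have hC : (#{v : Fin (s + 1 + 1) → Fin n → ZMod q |
      sumAnalyzer (s + 1 + 1) n v = ∑ i, x i} : ℝ) * q ≤ (q : ℝ) ^ (n * (s + 1)) * q ^ n := by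
    have := card_sumAnalyzer_eq_mul_card_le (m := s + 1) (show 0 < n by omega) (∑ i, x i)
    rw [ZMod.card, Nat.mul_succ n (s + 1), pow_add] at this
    exact_mod_cast this
  have hT : ∑ k ∈ piAntidiag (univ : Finset (ZMod q)) n, ∏ c, ((k c)! : ℝ) ^ s ≤
      (n ! : ℝ) ^ s * (q + q ^ 2 * (Real.exp 1 / n) ^ s) := by
    have h1 := sum_piAntidiag_le s (by omega) (univ : Finset (ZMod q)) n (by omega)
    rw [card_univ, ZMod.card] at h1
    have h2 := compositionBound_le (s := s) (by omega) hn hq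
    rw [div_le_iff₀ (by positivity), mul_comm] at h2
    exact h1.trans h2
  have hA := sum_card_consistentShuffles_sq (m := s + 1) x
  simp only [mul_pow, ← mul_sum] at hA
  rw [sum_prod_fiberCard_factorial, pow_succ (n ! : ℝ) s] at hA
  simp only [toReal_ikosRandomizedInputs_apply, div_pow _ _ 2, ← sum_div, ZMod.card]
  rw [pow_succ (n ! : ℝ) s]
  exact mul_div_sq_le_of_bounds (by positivity) (by positivity) (by positivity) hnf hq0
    (sum_nonneg fun _ _ => sq_nonneg _) hC hA hT

theorem two_rpow_neg_securityParameter {q m n : ℕ} (hq : 0 < q) (hn : 0 < n) :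
    (2 : ℝ) ^ (-securityParameter q m n) =
      √(q * (Real.exp 1 / n) ^ ((m : ℝ) - 1)) := by
  have hq' : (0 : ℝ) < q := by exact_mod_cast hq
  have hn' : (0 : ℝ) < n := by exact_mod_cast hn
  have hX : (0 : ℝ) < q * (Real.exp 1 / n) ^ ((m : ℝ) - 1) := by positivity
  have hlog : -securityParameter q m n =
      Real.logb 2 (q * (Real.exp 1 / n) ^ ((m : ℝ) - 1)) * (1 / 2) := by
    rw [Real.logb_mul hq'.ne' (by positivity), Real.logb_rpow_eq_mul_logb_of_pos (by positivity),
      Real.logb_div (by positivity) hn'.ne', securityParameter]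
    ring
  rw [hlog, Real.rpow_mul (by norm_num), Real.rpow_logb (by norm_num) (by norm_num) hX,
    Real.sqrt_eq_rpow]

theorem worstCaseSecure_securityParameter {q m n : ℕ} [NeZero q] (hn : 19 ≤ n) :
    WorstCaseSecure (ikosRandomizedInputs (G := ZMod q) m n) (sumAnalyzer (m + 1) n)
      (securityParameter q m n) := by
  refine ⟨computesExactSummation_ikosRandomizedInputs, fun x x' hx => ?_⟩
  have hq0 : 0 < q := Nat.pos_of_ne_zero (NeZero.ne q)
  have hq1 : (1 : ℝ) ≤ q := by exact_mod_cast hq0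
  have hn' : (19 : ℝ) ≤ n := by exact_mod_cast hn
  have he := Real.exp_one_lt_d9
  rw [two_rpow_neg_securityParameter hq0 (by omega)]
  obtain h1 | h1 := le_or_gt 1 ((q : ℝ) * (Real.exp 1 / n) ^ ((m : ℝ) - 1))
  · exact (tvDist_le_one _ _).trans (Real.one_le_sqrt.2 h1)
  -- For `m ≤ 1` the exponent is nonpositive and `e / n < 1`, so the bound would be at least `1`,
  -- the case already settled. From here the real exponent agrees with the natural number `m - 1`.
  have hm : 2 ≤ m := by
    by_contra! hm
    refine absurd h1 (not_lt.2 (one_le_mul_of_one_le_of_one_le hq1 ?_))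
    refine Real.one_le_rpow_of_pos_of_le_one_of_nonpos (by positivity) ?_ ?_
    · rw [div_le_one (by linarith)]
      linarith
    · have : (m : ℝ) ≤ 1 := by exact_mod_cast (show m ≤ 1 by omega)
      linarith
  have hpow : (Real.exp 1 / n) ^ ((m : ℝ) - 1) = (Real.exp 1 / n) ^ (m - 1) := by
    rw [← Real.rpow_natCast, Nat.cast_sub (by omega), Nat.cast_one]
  rw [hpow] at h1 ⊢
  -- The nontrivial case `B < 1` supplies the size condition on `q` needed by the collision bound.
  have hq : (q : ℝ) ≤ (n / Real.exp 1) ^ (m - 1) := by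
    have h2 : (Real.exp 1 / n) ^ (m - 1) * (n / Real.exp 1) ^ (m - 1) = 1 := by
      rw [← mul_pow, div_mul_div_cancel₀ (by positivity), div_self (by positivity), one_pow]
    calc (q : ℝ) = q * (Real.exp 1 / n) ^ (m - 1) * (n / Real.exp 1) ^ (m - 1) := by
          rw [mul_assoc, h2, mul_one]
      _ ≤ _ := mul_le_of_le_one_left (by positivity) h1.le
  have hS : ∀ y : Fin n → ZMod q, ∑ i, x i = ∑ i, y i → ∀ v, ikosRandomizedInputs m n y v ≠ 0 →
      v ∈ univ.filter fun v => sumAnalyzer (m + 1) n v = ∑ i, x i := by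
    intro y hy v hv
    rw [mem_filter, hy]
    exact ⟨mem_univ _, sumAnalyzer_eq_of_mem_support hv⟩
  refine tvDist_le_of_collision (hS x rfl) (hS x' hx) (Real.sqrt_nonneg _) ?_ ?_
  · rw [Real.sq_sqrt (by positivity)]
    exact card_mul_sum_sq_le hm hn hq x
  · rw [Real.sq_sqrt (by positivity), hx]
    exact card_mul_sum_sq_le hm hn hq x'

/-! ### From the security parameter to the number of messages -/

theorem WorstCaseSecure.mono {G Ω : Type*} [AddCommGroup G] {n : ℕ}
    {V : (Fin n → G) → PMF Ω} {A : Ω → G} {σ τ : ℝ} (h : WorstCaseSecure V A τ) (hστ : σ ≤ τ) :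
    WorstCaseSecure V A σ :=
  ⟨h.1, fun x x' hx => (h.2 x x' hx).trans
    (Real.rpow_le_rpow_of_exponent_le (by norm_num) (by linarith))⟩

theorem logb_sub_logb_exp_pos {n : ℕ} (hn : 19 ≤ n) :
    0 < Real.logb 2 n - Real.logb 2 (Real.exp 1) := by
  have hn' : (19 : ℝ) ≤ n := by exact_mod_cast hn
  have he := Real.exp_one_lt_d9
  exact sub_pos.2 (Real.logb_lt_logb (by norm_num) (by positivity) (by linarith))

theorem le_securityParameter {q m n : ℕ} {σ : ℝ} (hn : 19 ≤ n) (hm : messageBound q n σ ≤ m) :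
    σ ≤ securityParameter q m n := by
  have hL := logb_sub_logb_exp_pos hn
  rw [messageBound, ← le_sub_iff_add_le, div_le_iff₀ hL] at hm
  rw [securityParameter]
  linarith

theorem antitoneOn_messageBound {q : ℕ} {σ : ℝ} (h : 0 ≤ 2 * σ + Real.logb 2 q) :
    AntitoneOn (fun n : ℕ => messageBound q n σ) (Set.Ici 19) := by
  intro a ha b hb hab
  have hL := logb_sub_logb_exp_pos ha
  have ha0 : (0 : ℝ) < a := by exact_mod_cast (show 0 < a from lt_of_lt_of_le (by norm_num) ha)
  simp only [messageBound]
  have : Real.logb 2 a ≤ Real.logb 2 b :=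
    Real.logb_le_logb_of_le (by norm_num) ha0 (by exact_mod_cast hab)
  gcongr

theorem strictAntiOn_messageBound {q : ℕ} {σ : ℝ} (h : 0 < 2 * σ + Real.logb 2 q) :
    StrictAntiOn (fun n : ℕ => messageBound q n σ) (Set.Ici 19) := by
  intro a ha b hb hab
  have hL := logb_sub_logb_exp_pos ha
  have ha0 : (0 : ℝ) < a := by exact_mod_cast (show 0 < a from lt_of_lt_of_le (by norm_num) ha)
  simp only [messageBound]
  have : Real.logb 2 a < Real.logb 2 b :=
    Real.logb_lt_logb (by norm_num) ha0 (by exact_mod_cast hab)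
  gcongr

end Security

end ShuffleSum

theorem mainTheorem3 :
    (∀ (q m n : ℕ) [NeZero q], 3 ≤ m → 19 ≤ n →
      ShuffleSum.WorstCaseSecure
        (ShuffleSum.ikosRandomizedInputs (G := ZMod q) m n)
        (ShuffleSum.sumAnalyzer (m + 1) n)
        (ShuffleSum.securityParameter q m n)) ∧
    (∀ (q n : ℕ) [NeZero q] (σ : ℝ) (m : ℕ), 19 ≤ n →
      (m : ℤ) = ⌈ShuffleSum.messageBound q n σ⌉ →
      ShuffleSum.WorstCaseSecure
        (ShuffleSum.ikosRandomizedInputs (G := ZMod q) m n)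
        (ShuffleSum.sumAnalyzer (m + 1) n)
        σ) ∧
    (∀ (q : ℕ) [NeZero q] (σ : ℝ), 0 ≤ 2 * σ + Real.logb 2 q →
      AntitoneOn (fun n : ℕ => ⌈ShuffleSum.messageBound q n σ⌉) (Set.Ici 19)) ∧
    (∀ (q : ℕ) [NeZero q] (σ : ℝ), 0 < 2 * σ + Real.logb 2 q →
      StrictAntiOn (fun n : ℕ => ShuffleSum.messageBound q n σ) (Set.Ici 19)) := by
  refine ⟨fun q m n _ _ hn => ShuffleSum.worstCaseSecure_securityParameter hn,
    fun q n _ σ m hn hm => ?_, fun q _ σ h a ha b hb hab => ?_,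
    fun q _ σ h => ShuffleSum.strictAntiOn_messageBound h⟩
  · refine (ShuffleSum.worstCaseSecure_securityParameter hn).mono
      (ShuffleSum.le_securityParameter hn ?_)
    have h := Int.le_ceil (ShuffleSum.messageBound q n σ)
    rw [← hm] at h
    exact_mod_cast h
  · exact Int.ceil_mono (ShuffleSum.antitoneOn_messageBound h ha hb hab)
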